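/- Let $\Omega\subset\mathbb{R}^2$ be a bounded polygonal domain with Lipschitz boundary, and let $\{\mathcal{T}_h\}_{h\in(0,h_0)}$ be a family of conforming triangulations of $\Omega$, where $h$ is the largest diameter of an element of $\mathcal{T}_h$. Let $X_h$ be the space of continuous functions on $\overline\Omega$ that are affine on each element of $\mathcal{T}_h$, let $V_h=\{v\in X_h: v|_{\partial\Omega}=0\}$, and let $u(x_1,x_2)=x_1^2+x_2^2$, so that $-\Delta u=f$ with $f=-4$. For each $h$ let $g_h\in X_h$ be an arbitrary discrete Dirichlet lift (for example, the function in $X_h$ that equals $u$ at the boundary vertices and $0$ at the interior vertices), and let $U_h\in g_h+V_h$ be the finite element solution: $$\int_\Omega\nabla U_h\cdot\nabla v\,\mathrm{d}x=\int_\Omega f\,v\,\mathrm{d}x\qquad\text{for all } v\in V_h.$$ A straight band of length $L=(N+1)h$ of identical isosceles triangles with base length $h$ and height $\bar h>0$ consists of the triangles $K_i=P_iP_{i+1}Q_i$ $(0\le i\le N)$ and $\tilde K_i=Q_{i-1}Q_iP_i$ $(1\le i\le N)$, where $P_i=a+ih\,g$ and $Q_i=a+(i+\tfrac12)h\,g+\bar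 h\,n$ for some point $a$ and some orthonormal vectors $g,n$. Let $C_L>0$ be any fixed constant. Suppose that there is a sequence $h_k\to0$ in $(0,h_0)$ such that each $\mathcal{T}_{h_k}$ contains all the triangles of such a band, with base length $h_k$, length $L_k\ge C_L$ and height $\bar h_k$, where $\bar h_k=o(h_k^4)$ as $k\to\infty$. Then the finite element method does not converge in $H^1(\Omega)$ on $\{\mathcal{T}_h\}_{h\in(0,h_0)}$ for this $u$; more precisely, even the seminorm $$|u-U_h|_{H^1(\Omega)}=\Big(\int_\Omega|\nabla(u-U_h)|^2\,\mathrm{d}x\Big)^{1/2}$$ does not tend to $0$ as $h\to0$. -/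

import Mathlib

open Set Filter Topology MeasureTheory Asymptotics
open scoped NNReal ENNReal

noncomputable section

/-- The Euclidean plane. -/
abbrev Plane : Type := EuclideanSpace ℝ (Fin 2)

/-- `Ω` has Lipschitz boundary: near each boundary point, in suitable Cartesian coordinates,
`Ω` is the set of points strictly below the graph of a Lipschitz function. -/
def HasLipschitzBoundary (Ω : Set Plane) : Prop :=
  ∀ x ∈ frontier Ω, ∃ (A : Plane ≃ₗᵢ[ℝ] Plane) (φ : ℝ → ℝ) (C : ℝ≥0) (r : ℝ),
    0 < r ∧ LipschitzWith C φ ∧ ∀ y ∈ Metric.ball x r, (y ∈ Ω ↔ A y 1 < φ (A y 0))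

/-- A bounded polygonal domain with Lipschitz boundary in the plane. -/
structure IsPolygonalDomain (Ω : Set Plane) : Prop where
  isOpen : IsOpen Ω
  isConnected : IsConnected Ω
  isBounded : Bornology.IsBounded Ω
  polygonal : ∃ S : Set (Plane × Plane), S.Finite ∧ frontier Ω = ⋃ p ∈ S, segment ℝ p.1 p.2
  lipschitz : HasLipschitzBoundary Ω

/-- A conforming triangulation of `Ω`. An element is represented by its set `K` of three
vertices; the closed triangle itself is `convexHull ℝ K`. -/
structure Triangulation (Ω : Set Plane) where
  /-- the vertex sets of the elements -/
  elements : Set (Set Plane)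
  finite : elements.Finite
  /-- every element has three vertices -/
  ncard_eq : ∀ K ∈ elements, K.ncard = 3
  /-- no element is degenerate -/
  indep : ∀ K ∈ elements, AffineIndependent ℝ ((↑) : K → Plane)
  /-- two elements meet in the convex hull of their common vertices, that is, they are
  disjoint, or share exactly one vertex, or exactly one whole edge, or coincide -/
  conforming : ∀ K ∈ elements, ∀ K' ∈ elements,
    convexHull ℝ K ∩ convexHull ℝ K' = convexHull ℝ (K ∩ K')
  /-- the closed triangles cover exactly the closure of `Ω` -/
  cover : ⋃ K ∈ elements, convexHull ℝ K = closure Ω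

namespace Triangulation

variable {Ω : Set Plane}

/-- `h` is the mesh size of `T`, i.e. the largest diameter of an element. -/
def HasMeshSize (T : Triangulation Ω) (h : ℝ) : Prop :=
  IsGreatest ((fun K => Metric.diam (convexHull ℝ K)) '' T.elements) h

/-- The finite element space `X_h`: continuous functions on the closure of `Ω` that are affine
on each element. Values outside the closure of `Ω` play no role. -/
def femSpace (T : Triangulation Ω) : Set (Plane → ℝ) :=
  {v | ContinuousOn v (closure Ω) ∧
    ∀ K ∈ T.elements, ∃ (l : Plane →ₗ[ℝ] ℝ) (c : ℝ), ∀ x ∈ convexHull ℝ K, v x = l x + c}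

/-- The space `V_h` of the functions in `X_h` with zero boundary values. -/
def femSpace₀ (T : Triangulation Ω) : Set (Plane → ℝ) :=
  {v | v ∈ T.femSpace ∧ ∀ x ∈ frontier Ω, v x = 0}

/-- `U` is the finite element solution of `-Δ u = f` with discrete Dirichlet lift `g ∈ X_h`:
`U = U₀ + g` with `U₀ ∈ V_h` and `a(U, v) = (f, v)` for all `v ∈ V_h`, where
`a(U, v) = ∫_Ω ∇U · ∇v`. Functions in `X_h` are affine in the interior of each element, so
their weak gradient is almost everywhere the classical gradient used here. -/
def IsFEMSolution (T : Triangulation Ω) (f g U : Plane → ℝ) : Prop :=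
  (∃ U₀ ∈ T.femSpace₀, ∀ x, U x = U₀ x + g x) ∧
    ∀ v ∈ T.femSpace₀,
      ∫ x in Ω, inner ℝ (gradient U x) (gradient v x) = ∫ x in Ω, f x * v x

/-- `T` contains a straight band `K₀, K̃₁, K₁, …, K̃_N, K_N` of identical isosceles triangles of
base length `h` and height `hbar`. The vertices lie on two parallel lines with unit direction
`g` and unit normal `n`: the points `P i = a + i h g` on the line of the band's edge `Γ`, and
`Q i = a + (i + 1/2) h g + hbar n` on the opposite line. The triangles
`K_i = {P i, P (i+1), Q i}` have their bases on `Γ` (so `Γ` has length `(N + 1) h`), and the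
triangles `K̃_{i+1} = {Q i, Q (i+1), P (i+1)}` between `K_i` and `K_{i+1}` have their bases on
the opposite line. -/
def ContainsBand (T : Triangulation Ω) (h hbar : ℝ) (N : ℕ) : Prop :=
  ∃ a g n : Plane, ‖g‖ = 1 ∧ ‖n‖ = 1 ∧ inner ℝ g n = 0 ∧
    ∃ P Q : ℕ → Plane,
      (∀ i : ℕ, P i = a + ((i : ℝ) * h) • g) ∧
      (∀ i : ℕ, Q i = a + (((i : ℝ) + 1 / 2) * h) • g + hbar • n) ∧
      (∀ i ≤ N, {P i, P (i + 1), Q i} ∈ T.elements) ∧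
      (∀ i < N, {Q i, Q (i + 1), P (i + 1)} ∈ T.elements)

end Triangulation

/-- The `H¹(Ω)`-seminorm `|v|_1 = (∫_Ω |∇v|²)^{1/2}`, with values in `[0, ∞]`, of a function
whose weak gradient is almost everywhere its classical gradient (for instance, a continuous
and piecewise smooth function). -/
def h1Seminorm (Ω : Set Plane) (v : Plane → ℝ) : ℝ≥0∞ :=
  eLpNorm (gradient v) 2 (volume.restrict Ω)

/-- The exact solution `u(x₁, x₂) = x₁² + x₂²`, for which `-Δ u = -4`. -/
def quadSol (x : Plane) : ℝ := x 0 ^ 2 + x 1 ^ 2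

end

/-!
Two neighbouring triangles of a band share a leg, whose slope is `± 2 * hbar / h`. Continuity along
this leg forces the tangential slopes of a finite element function on the two triangles to differ by
at most `2 * hbar / h` times its normal slopes. If the `H¹` seminorm stays bounded, the
Cauchy–Schwarz inequality over the band shows that all tangential slopes along one long edge of the
band agree up to a multiple of `(hbar / h ^ 4) ^ (1 / 2)`. Hence `hbar = o(h ^ 4)` makes every such
function almost affine on a segment of fixed length, whereas the second differences of `quadSol`
along that segment do not vanish.

A trace inequality turns this discrepancy into a lower bound for the seminorm of the error. It is
uniform in the position of the segment, which may touch the boundary, because near each point of the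
closure of a Lipschitz domain there is an open set of inward directions, some of them transversal to
the segment, and the closure is compact.
-/

section GradientAlongLines

theorem enorm_sub_le_setLIntegral_of_hasDerivAt {F : Type*} [NormedAddCommGroup F]
    [NormedSpace ℝ F] [CompleteSpace F] {f f' : ℝ → F} {a b : ℝ} (hab : a ≤ b)
    (hc : ContinuousOn f (Icc a b)) {s : Set ℝ} (hs : s.Countable)
    (hd : ∀ x ∈ Ioo a b \ s, HasDerivAt f (f' x) x)
    (hm : AEStronglyMeasurable f' (volume.restrict (Ioc a b))) :
    ‖f b - f a‖ₑ ≤ ∫⁻ x in Ioc a b, ‖f' x‖ₑ := by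
  by_cases hfin : ∫⁻ x in Ioc a b, ‖f' x‖ₑ = ⊤
  · simp [hfin]
  have hint : IntervalIntegrable f' volume a b := by
    rw [intervalIntegrable_iff_integrableOn_Ioc_of_le hab]
    exact ⟨hm, lt_top_iff_ne_top.2 hfin⟩
  rw [← integral_eq_of_hasDerivAt_off_countable_of_le f f' hab hs hc hd hint,
    intervalIntegral.integral_of_le hab]
  exact enorm_integral_le_lintegral_enorm _

theorem hasDerivAt_comp_add_smul {E : Type*} [NormedAddCommGroup E] [NormedSpace ℝ E]
    {w : E → ℝ} {q e : E} {t : ℝ}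
    (h : DifferentiableAt ℝ w (q + t • e)) :
    HasDerivAt (fun t : ℝ ↦ w (q + t • e)) (fderiv ℝ w (q + t • e) e) t := by
  have hline : HasDerivAt (fun t : ℝ ↦ q + t • e) e t := by
    simpa using ((hasDerivAt_id t).smul_const e).const_add q
  exact h.hasFDerivAt.comp_hasDerivAt t hline

variable {E : Type*} [NormedAddCommGroup E] [InnerProductSpace ℝ E] [CompleteSpace E]

theorem enorm_gradient (w : E → ℝ) (x : E) : ‖gradient w x‖ₑ = ‖fderiv ℝ w x‖ₑ := by
  rw [← ofReal_norm, ← ofReal_norm, gradient, LinearIsometryEquiv.norm_map]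

variable [MeasurableSpace E] [BorelSpace E]

theorem measurable_gradient (w : E → ℝ) : Measurable (gradient w) :=
  (InnerProductSpace.toDual ℝ E).symm.continuous.measurable.comp (measurable_fderiv ℝ w)

theorem enorm_sub_le_setLIntegral_gradient {Ω : Set E} {w : E → ℝ}
    (hw : ContinuousOn w (closure Ω)) {q e : E} {a b : ℝ} (hab : a ≤ b)
    (hmem : ∀ t ∈ Ioo a b, q + t • e ∈ Ω)
    (hdiff : ∀ᶠ t : ℝ in cofinite, q + t • e ∈ Ω → DifferentiableAt ℝ w (q + t • e)) :
    ‖w (q + b • e) - w (q + a • e)‖ₑ ≤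
      ‖e‖ₑ * ∫⁻ t in Ioc a b, ‖gradient w (q + t • e)‖ₑ := by
  rcases hab.eq_or_lt with rfl | hlt
  · simp
  have hline : Continuous fun t : ℝ ↦ q + t • e := by fun_prop
  have hcl : MapsTo (fun t : ℝ ↦ q + t • e) (Icc a b) (closure Ω) := by
    rw [← closure_Ioo hlt.ne]
    exact MapsTo.closure hmem hline
  have hderiv_meas : Measurable fun t : ℝ ↦ fderiv ℝ w (q + t • e) e :=
    (measurable_fderiv_apply_const ℝ w e).comp hline.measurable
  calc ‖w (q + b • e) - w (q + a • e)‖ₑ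
      ≤ ∫⁻ t in Ioc a b, ‖fderiv ℝ w (q + t • e) e‖ₑ := by
        refine enorm_sub_le_setLIntegral_of_hasDerivAt (f := fun t ↦ w (q + t • e)) hab
          (hw.comp hline.continuousOn hcl) (eventually_cofinite.1 hdiff).countable
          (fun t ht ↦ hasDerivAt_comp_add_smul ?_) hderiv_meas.aestronglyMeasurable
        exact not_not.1 ht.2 (hmem t ht.1)
    _ ≤ ∫⁻ t in Ioc a b, ‖e‖ₑ * ‖gradient w (q + t • e)‖ₑ := by
        refine lintegral_mono fun t ↦ ?_
        rw [enorm_gradient, mul_comm]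
        exact ContinuousLinearMap.le_opENorm _ _
    _ = ‖e‖ₑ * ∫⁻ t in Ioc a b, ‖gradient w (q + t • e)‖ₑ :=
        lintegral_const_mul' _ _ enorm_ne_top

end GradientAlongLines

theorem setLIntegral_comp_add_right_le (f : ℝ → ℝ≥0∞) {m : ℝ} (hm : 0 ≤ m) (ℓ : ℝ) :
    ∫⁻ s in Ioc 0 (ℓ - m), f (s + m) ≤ ∫⁻ s in Ioc 0 ℓ, f s := by
  rw [← (measurePreserving_add_right volume m).setLIntegral_comp_preimage_emb
    (measurableEmbedding_addRight m) f (Ioc 0 ℓ)]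
  refine lintegral_mono_set fun s hs ↦ ?_
  simp only [mem_preimage, mem_Ioc] at hs ⊢
  constructor <;> linarith

theorem ofReal_mul_edist_le_add_setLIntegral {X : Type*} [PseudoEMetricSpace X] {x y : X}
    {x' y' : ℝ → X} {A B : ℝ≥0∞} {H : ℝ → ℝ≥0∞} {δ : ℝ}
    (hx : ∀ t ∈ Ioc 0 δ, edist (x' t) x ≤ A) (hy : ∀ t ∈ Ioc 0 δ, edist (y' t) y ≤ B)
    (hxy : ∀ᵐ t : ℝ, t ∈ Ioc 0 δ → edist (x' t) (y' t) ≤ H t) :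
    ENNReal.ofReal δ * edist x y ≤ ENNReal.ofReal δ * (A + B) + ∫⁻ t in Ioc 0 δ, H t := by
  calc ENNReal.ofReal δ * edist x y = ∫⁻ _ in Ioc 0 δ, edist x y := by simp [mul_comm]
    _ ≤ ∫⁻ t in Ioc 0 δ, ((A + B) + H t) := by
        refine lintegral_mono_ae ((ae_restrict_iff' measurableSet_Ioc).2 ?_)
        filter_upwards [hxy] with t ht hmem
        calc edist x y ≤ edist x (x' t) + edist (x' t) (y' t) + edist (y' t) y :=
              edist_triangle4 _ _ _ _
          _ ≤ A + H t + B := by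
              rw [edist_comm x]
              exact add_le_add (add_le_add (hx t hmem) (ht hmem)) (hy t hmem)
          _ = (A + B) + H t := by ring
    _ = ENNReal.ofReal δ * (A + B) + ∫⁻ t in Ioc 0 δ, H t := by
        rw [lintegral_add_left measurable_const]
        simp [mul_comm]

/- A trace inequality: move both end points of the increment from height `0` to height `t`,
compare them there, and average over `t`. -/
theorem setLIntegral_edist_le_of_upperGradient {X : Type*} [PseudoEMetricSpace X]
    {v : ℝ → ℝ → X} {ρ : ℝ → ℝ → ℝ≥0∞} (hρ : Measurable (Function.uncurry ρ)) {m ℓ δ : ℝ}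
    (hm : 0 ≤ m)
    (hvert : ∀ᵐ s : ℝ, s ∈ Ioc 0 ℓ → ∀ t ∈ Ioc 0 δ, edist (v s t) (v s 0) ≤ ∫⁻ t in Ioc 0 δ, ρ s t)
    (hhor : ∀ᵐ t : ℝ, t ∈ Ioc 0 δ → ∀ s ∈ Ioc 0 (ℓ - m),
      edist (v (s + m) t) (v s t) ≤ ∫⁻ s in Ioc 0 ℓ, ρ s t) :
    ENNReal.ofReal δ * ∫⁻ s in Ioc 0 (ℓ - m), edist (v (s + m) 0) (v s 0) ≤
      (2 * ENNReal.ofReal δ + ENNReal.ofReal (ℓ - m)) *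
        ∫⁻ s in Ioc 0 ℓ, ∫⁻ t in Ioc 0 δ, ρ s t := by
  set V : ℝ → ℝ≥0∞ := fun s ↦ ∫⁻ t in Ioc 0 δ, ρ s t
  set H : ℝ → ℝ≥0∞ := fun t ↦ ∫⁻ s in Ioc 0 ℓ, ρ s t
  set I : ℝ≥0∞ := ∫⁻ s in Ioc 0 ℓ, V s
  have hVm : Measurable V := hρ.lintegral_prod_right'
  have hHI : ∫⁻ t in Ioc 0 δ, H t = I := (lintegral_lintegral_swap hρ.aemeasurable).symm
  have hshift : ∀ᵐ s : ℝ, s + m ∈ Ioc 0 ℓ → ∀ t ∈ Ioc 0 δ,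
      edist (v (s + m) t) (v (s + m) 0) ≤ V (s + m) :=
    (measurePreserving_add_right volume m).quasiMeasurePreserving.ae hvert
  have hslice : ∀ᵐ s : ℝ, s ∈ Ioc 0 (ℓ - m) → ENNReal.ofReal δ * edist (v (s + m) 0) (v s 0) ≤
      ENNReal.ofReal δ * (V s + V (s + m)) + I := by
    filter_upwards [hvert, hshift] with s hs hsm hsmem
    rw [add_comm (V s), ← hHI]
    refine ofReal_mul_edist_le_add_setLIntegral
      (hsm ⟨by linarith [hsmem.1], by linarith [hsmem.2]⟩) (hs ⟨hsmem.1, by linarith [hsmem.2]⟩) ?_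
    filter_upwards [hhor] with t ht htmem using ht htmem s hsmem
  calc ENNReal.ofReal δ * ∫⁻ s in Ioc 0 (ℓ - m), edist (v (s + m) 0) (v s 0)
      = ∫⁻ s in Ioc 0 (ℓ - m), ENNReal.ofReal δ * edist (v (s + m) 0) (v s 0) :=
        (lintegral_const_mul' _ _ ENNReal.ofReal_ne_top).symm
    _ ≤ ∫⁻ s in Ioc 0 (ℓ - m), (ENNReal.ofReal δ * (V s + V (s + m)) + I) :=
        lintegral_mono_ae ((ae_restrict_iff' measurableSet_Ioc).2 hslice)
    _ = ENNReal.ofReal δ * ((∫⁻ s in Ioc 0 (ℓ - m), V s) + ∫⁻ s in Ioc 0 (ℓ - m), V (s + m)) +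
          ENNReal.ofReal (ℓ - m) * I := by
        rw [lintegral_add_right _ measurable_const, lintegral_const_mul _ (by fun_prop),
          lintegral_add_left hVm]
        simp [mul_comm]
    _ ≤ ENNReal.ofReal δ * (I + I) + ENNReal.ofReal (ℓ - m) * I := by
        gcongr
        · exact lintegral_mono_set (Ioc_subset_Ioc_right (by linarith))
        · exact setLIntegral_comp_add_right_le _ hm ℓ
    _ = (2 * ENNReal.ofReal δ + ENNReal.ofReal (ℓ - m)) * I := by ring

section PlaneCharts

/-- The oriented area of the parallelogram spanned by two vectors of the plane. -/
def cross (g e : Plane) : ℝ := g 0 * e 1 - g 1 * e 0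

/-- The affine parametrization of the plane with base point `p` and axes `g` and `e`. -/
noncomputable def planeChart (p g e : Plane) (z : ℝ × ℝ) : Plane := p + z.1 • g + z.2 • e

theorem cross_swap (g e : Plane) : cross e g = -cross g e := by
  simp only [cross]; ring

theorem abs_cross_eq_one {g n : Plane} (hg : ‖g‖ = 1) (hn : ‖n‖ = 1)
    (hgn : inner ℝ g n = 0) : |cross g n| = 1 := by
  have hg' := EuclideanSpace.real_norm_sq_eq g
  have hn' := EuclideanSpace.real_norm_sq_eq n
  have hgn' : n 0 * g 0 + n 1 * g 1 = 0 := by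
    simpa [PiLp.inner_apply, Fin.sum_univ_two] using hgn
  rw [hg, Fin.sum_univ_two] at hg'
  rw [hn, Fin.sum_univ_two] at hn'
  refine (sq_eq_sq₀ (abs_nonneg _) zero_le_one).1 ?_
  rw [sq_abs, cross]
  linear_combination (-(n 0 ^ 2 + n 1 ^ 2)) * hg' - hn' - (n 0 * g 0 + n 1 * g 1) * hgn'

theorem continuous_planeChart (p g e : Plane) : Continuous (planeChart p g e) := by
  unfold planeChart; fun_prop

theorem map_planeChart_volume (p : Plane) {g e : Plane} (hd : cross g e ≠ 0) :
    Measure.map (planeChart p g e) volume = ENNReal.ofReal |cross g e|⁻¹ • volume := by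
  let M : Matrix (Fin 2) (Fin 2) ℝ := !![g 0, e 0; g 1, e 1]
  have hM : M.det = cross g e := by simp [M, Matrix.det_fin_two, cross]; ring
  have hchart : planeChart p g e = (fun x ↦ p + x) ∘ WithLp.toLp 2 ∘ Matrix.toLin' M ∘
      (MeasurableEquiv.finTwoArrow (α := ℝ)).symm := by
    ext z i
    fin_cases i <;> simp [planeChart, M, Matrix.toLin'_apply, MeasurableEquiv.finTwoArrow] <;> ring
  have htoLp := PiLp.volume_preserving_toLp (Fin 2)
  have hlin : Measurable (Matrix.toLin' M) :=
    (Matrix.toLin' M).continuous_of_finiteDimensional.measurable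
  rw [hchart, ← Measure.map_map (measurable_const_add p)
      (htoLp.measurable.comp (hlin.comp (MeasurableEquiv.measurable _))),
    ← Measure.map_map htoLp.measurable (hlin.comp (MeasurableEquiv.measurable _)),
    ← Measure.map_map hlin (MeasurableEquiv.measurable _),
    (volume_preserving_finTwoArrow ℝ).symm.map_eq,
    Real.map_matrix_volume_pi_eq_smul_volume_pi (by rwa [hM]), Measure.map_smul,
    htoLp.map_eq, Measure.map_smul, map_add_left_eq_self, hM, abs_inv]

theorem ae_planeChart (p : Plane) {g e : Plane} (hd : cross g e ≠ 0) {P : Plane → Prop}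
    (hP : ∀ᵐ x, P x) : ∀ᵐ z, P (planeChart p g e z) := by
  refine ae_of_ae_map (continuous_planeChart p g e).aemeasurable ?_
  rw [map_planeChart_volume p hd]
  exact Measure.ae_smul_measure hP _

theorem setLIntegral_planeChart_le (p : Plane) {g e : Plane} (hd : cross g e ≠ 0)
    {f : Plane → ℝ≥0∞} (hf : Measurable f) {Ω : Set Plane} (hΩ : MeasurableSet Ω)
    {B : Set (ℝ × ℝ)} (hBΩ : ∀ᵐ z, z ∈ B → planeChart p g e z ∈ Ω) :
    ∫⁻ z in B, f (planeChart p g e z) ≤ ENNReal.ofReal |cross g e|⁻¹ * ∫⁻ x in Ω, f x := by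
  have hchart := (continuous_planeChart p g e).measurable
  calc ∫⁻ z in B, f (planeChart p g e z)
      ≤ ∫⁻ z in planeChart p g e ⁻¹' Ω, f (planeChart p g e z) :=
        lintegral_mono' (Measure.restrict_mono_ae hBΩ) le_rfl
    _ = ENNReal.ofReal |cross g e|⁻¹ * ∫⁻ x in Ω, f x := by
        rw [← setLIntegral_map hΩ hf hchart, map_planeChart_volume p hd, Measure.restrict_smul,
          lintegral_smul_measure, smul_eq_mul]

end PlaneCharts

section Seminorm

variable {Ω : Set Plane} {w : Plane → ℝ}

theorem h1Seminorm_sq (Ω : Set Plane) (w : Plane → ℝ) :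
    h1Seminorm Ω w ^ 2 = ∫⁻ x in Ω, ‖gradient w x‖ₑ ^ 2 := by
  have := eLpNorm_nnreal_pow_eq_lintegral (f := gradient w) (μ := volume.restrict Ω)
    (p := 2) two_ne_zero
  simpa [h1Seminorm] using this

theorem setLIntegral_enorm_gradient_le (Ω : Set Plane) (w : Plane → ℝ) :
    ∫⁻ x in Ω, ‖gradient w x‖ₑ ≤ h1Seminorm Ω w * volume Ω ^ (1 / 2 : ℝ) := by
  have := eLpNorm_le_eLpNorm_mul_rpow_measure_univ (μ := volume.restrict Ω) one_le_two
    (measurable_gradient w).aestronglyMeasurable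
  rw [eLpNorm_one_eq_lintegral_enorm, Measure.restrict_apply_univ] at this
  convert this using 3
  · rfl
  · norm_num

theorem lintegral_box_enorm_gradient_le (hΩ : MeasurableSet Ω) (w : Plane → ℝ) {p g e : Plane}
    (hd : cross g e ≠ 0) {ℓ δ : ℝ}
    (hmem : ∀ s ∈ Ioc 0 ℓ, ∀ t ∈ Ioc 0 δ, p + s • g + t • e ∈ Ω) :
    ∫⁻ s in Ioc 0 ℓ, ∫⁻ t in Ioc 0 δ, ‖gradient w (p + s • g + t • e)‖ₑ ≤
      ENNReal.ofReal |cross g e|⁻¹ * (h1Seminorm Ω w * volume Ω ^ (1 / 2 : ℝ)) := by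
  have hgrad : Measurable fun x ↦ ‖gradient w x‖ₑ := (measurable_gradient w).enorm
  calc ∫⁻ s in Ioc 0 ℓ, ∫⁻ t in Ioc 0 δ, ‖gradient w (p + s • g + t • e)‖ₑ
      = ∫⁻ z in Ioc 0 ℓ ×ˢ Ioc 0 δ, ‖gradient w (planeChart p g e z)‖ₑ :=
        (setLIntegral_prod _
          (hgrad.comp (continuous_planeChart p g e).measurable).aemeasurable).symm
    _ ≤ ENNReal.ofReal |cross g e|⁻¹ * ∫⁻ x in Ω, ‖gradient w x‖ₑ :=
        setLIntegral_planeChart_le p hd hgrad hΩ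
          (ae_of_all _ fun z hz ↦ hmem z.1 hz.1 z.2 hz.2)
    _ ≤ ENNReal.ofReal |cross g e|⁻¹ * (h1Seminorm Ω w * volume Ω ^ (1 / 2 : ℝ)) := by
        gcongr
        exact setLIntegral_enorm_gradient_le Ω w

theorem ae_of_eventually_cofinite {α : Type*} [MeasurableSpace α] {μ : Measure α}
    [NullSingletonClass μ] {P : α → Prop} (h : ∀ᶠ t in cofinite, P t) : ∀ᵐ t ∂μ, P t := by
  filter_upwards [(eventually_cofinite.1 h).countable.ae_notMem μ] with t ht
  exact not_not.1 ht

theorem setLIntegral_enorm_sub_le_h1Seminorm (hΩ : MeasurableSet Ω)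
    (hw : ContinuousOn w (closure Ω))
    (hdiff : ∀ p g e : Plane, cross g e ≠ 0 → ∀ᶠ s : ℝ in cofinite, ∀ᶠ t : ℝ in cofinite,
      p + s • g + t • e ∈ Ω → DifferentiableAt ℝ w (p + s • g + t • e))
    {p g e : Plane} (hg : ‖g‖ ≤ 1) (he : ‖e‖ ≤ 1) (hd : cross g e ≠ 0) {m ℓ δ : ℝ} (hm : 0 ≤ m)
    (hmem : ∀ s ∈ Ioc 0 ℓ, ∀ t ∈ Ioc 0 δ, p + s • g + t • e ∈ Ω) :
    ENNReal.ofReal δ *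
        ∫⁻ s in Ioc 0 (ℓ - m), ‖w (p + (s + m) • g) - w (p + s • g)‖ₑ ≤
      (2 * ENNReal.ofReal δ + ENNReal.ofReal (ℓ - m)) * (ENNReal.ofReal |cross g e|⁻¹ *
        (h1Seminorm Ω w * volume Ω ^ (1 / 2 : ℝ))) := by
  have hline {q v : Plane} (hv : ‖v‖ ≤ 1) {a b : ℝ} (hab : a ≤ b)
      (hqv : ∀ t ∈ Ioo a b, q + t • v ∈ Ω)
      (hd : ∀ᶠ t : ℝ in cofinite, q + t • v ∈ Ω → DifferentiableAt ℝ w (q + t • v)) :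
      edist (w (q + b • v)) (w (q + a • v)) ≤ ∫⁻ t in Ioc a b, ‖gradient w (q + t • v)‖ₑ := by
    rw [edist_eq_enorm_sub]
    refine (enorm_sub_le_setLIntegral_gradient hw hab hqv hd).trans (mul_le_of_le_one_left' ?_)
    rw [← ofReal_norm]
    exact ENNReal.ofReal_le_one.2 hv
  have hρ : Measurable (Function.uncurry fun s t : ℝ ↦ ‖gradient w (p + s • g + t • e)‖ₑ) :=
    (measurable_gradient w).enorm.comp (continuous_planeChart p g e).measurable
  have htrace := setLIntegral_edist_le_of_upperGradient (v := fun s t ↦ w (p + s • g + t • e))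
    (ℓ := ℓ) (δ := δ) hρ hm ?_ ?_
  · simp only [zero_smul, add_zero, edist_eq_enorm_sub] at htrace
    exact htrace.trans (mul_le_mul_right (lintegral_box_enorm_gradient_le hΩ w hd hmem) _)
  · filter_upwards [ae_of_eventually_cofinite (hdiff p g e hd)] with s hs hsmem t ht
    refine (hline he ht.1.le (fun τ hτ ↦ hmem s hsmem τ ⟨hτ.1, hτ.2.le.trans ht.2⟩) hs).trans ?_
    exact lintegral_mono_set (Ioc_subset_Ioc_right ht.2)
  · have hd' : cross e g ≠ 0 := by rwa [cross_swap, neg_ne_zero]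
    filter_upwards [ae_of_eventually_cofinite (hdiff p e g hd')] with t ht htmem s hs
    simp only [add_right_comm p _ (t • e)]
    have hsub : Ioc s (s + m) ⊆ Ioc 0 ℓ := Ioc_subset_Ioc hs.1.le (by linarith [hs.2])
    refine (hline hg (by linarith) (fun σ hσ ↦ ?_) ht).trans (lintegral_mono_set hsub)
    rw [add_right_comm]
    exact hmem σ (hsub (Ioo_subset_Ioc_self hσ)) t htmem

end Seminorm

section LipschitzBoundary

/-- `e` is a direction along which one can move a fixed distance from every point of the closure
of `Ω` near `x`, immediately entering `Ω`. -/
def IsInwardAt (Ω : Set Plane) (x e : Plane) : Prop :=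
  ∃ r > 0, ∀ y ∈ closure Ω, dist y x < r → ∀ t ∈ Ioo 0 r, y + t • e ∈ Ω

variable {Ω : Set Plane} {x : Plane}

theorem dist_add_smul_lt {y e : Plane} {r t : ℝ} (he : ‖e‖ ≤ 1) (hy : dist y x < r / 2)
    (ht : t ∈ Ioo 0 (r / 2)) : dist (y + t • e) x < r := by
  calc dist (y + t • e) x ≤ dist (y + t • e) y + dist y x := dist_triangle _ _ _
    _ = t * ‖e‖ + dist y x := by
      rw [dist_self_add_left, norm_smul, Real.norm_of_nonneg ht.1.le]
    _ < r := by nlinarith [ht.1, ht.2]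

theorem isInwardAt_of_mem (hO : IsOpen Ω) (hx : x ∈ Ω) {e : Plane} (he : ‖e‖ ≤ 1) :
    IsInwardAt Ω x e := by
  obtain ⟨r, hr, hball⟩ := Metric.isOpen_iff.1 hO x hx
  exact ⟨r / 2, half_pos hr, fun y _ hy t ht ↦ hball (dist_add_smul_lt he hy ht)⟩

theorem apply_le_of_mem_closure {A : Plane ≃ₗᵢ[ℝ] Plane} {φ : ℝ → ℝ} {r : ℝ} (hφ : Continuous φ)
    (h : ∀ y ∈ Metric.ball x r, (y ∈ Ω ↔ A y 1 < φ (A y 0))) {y : Plane}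
    (hy : y ∈ closure Ω) (hyx : y ∈ Metric.ball x r) : A y 1 ≤ φ (A y 0) := by
  have hclosed : IsClosed {y : Plane | A y 1 ≤ φ (A y 0)} :=
    isClosed_le (by fun_prop) (hφ.comp (by fun_prop))
  exact closure_minimal (fun z hz ↦ ((h z hz.1).1 hz.2).le) hclosed
    (Metric.isOpen_ball.inter_closure ⟨hyx, hy⟩)

theorem isInwardAt_of_lt_neg_mul_abs {A : Plane ≃ₗᵢ[ℝ] Plane} {φ : ℝ → ℝ} {C : ℝ≥0} {r : ℝ}
    (hr : 0 < r) (hφ : LipschitzWith C φ)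
    (h : ∀ y ∈ Metric.ball x r, (y ∈ Ω ↔ A y 1 < φ (A y 0))) {e : Plane} (he : ‖e‖ ≤ 1)
    (hcone : A e 1 < -(C * |A e 0|)) : IsInwardAt Ω x e := by
  refine ⟨r / 2, half_pos hr, fun y hy hyx t ht ↦ ?_⟩
  have hle := apply_le_of_mem_closure hφ.continuous h hy
    (Metric.mem_ball.2 (hyx.trans (half_lt_self hr)))
  have hlip : φ (A y 0) - φ (A (y + t • e) 0) ≤ C * (t * |A e 0|) := by
    calc φ (A y 0) - φ (A (y + t • e) 0) ≤ dist (φ (A y 0)) (φ (A (y + t • e) 0)) :=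
          le_abs_self _
      _ ≤ C * dist (A y 0) (A (y + t • e) 0) := hφ.dist_le_mul _ _
      _ = C * (t * |A e 0|) := by simp [abs_of_pos ht.1]
  refine (h _ (dist_add_smul_lt he hyx ht)).2 ?_
  have hval : A (y + t • e) 1 = A y 1 + t * A e 1 := by simp
  nlinarith [mul_lt_mul_of_pos_left hcone ht.1]

theorem HasLipschitzBoundary.exists_isOpen_isInwardAt (h : HasLipschitzBoundary Ω) (hO : IsOpen Ω)
    (hx : x ∈ closure Ω) :
    ∃ D : Set Plane, IsOpen D ∧ D.Nonempty ∧ ∀ e ∈ D, ‖e‖ ≤ 1 ∧ IsInwardAt Ω x e := by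
  by_cases hxΩ : x ∈ Ω
  · refine ⟨Metric.ball 0 1, Metric.isOpen_ball, ⟨0, by simp⟩, fun e he ↦ ?_⟩
    have he' : ‖e‖ ≤ 1 := (mem_ball_zero_iff.1 he).le
    exact ⟨he', isInwardAt_of_mem hO hxΩ he'⟩
  obtain ⟨A, φ, C, r, hr, hφ, hloc⟩ := h x (by rw [hO.frontier_eq]; exact ⟨hx, hxΩ⟩)
  refine ⟨Metric.ball 0 1 ∩ {e | A e 1 < -(C * |A e 0|)},
    Metric.isOpen_ball.inter (isOpen_lt (by fun_prop) (by fun_prop)),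
    ⟨A.symm !₂[0, -1 / 2], ?_, ?_⟩, fun e he ↦ ?_⟩
  · rw [mem_ball_zero_iff, LinearIsometryEquiv.norm_map, EuclideanSpace.norm_eq]
    norm_num [Fin.sum_univ_two]
  · norm_num
  · have he' : ‖e‖ ≤ 1 := (mem_ball_zero_iff.1 he.1).le
    exact ⟨he', isInwardAt_of_lt_neg_mul_abs hr hφ hloc he' he.2⟩

theorem HasLipschitzBoundary.interior_closure_subset (h : HasLipschitzBoundary Ω)
    (hO : IsOpen Ω) : interior (closure Ω) ⊆ Ω := by
  intro x hx
  obtain ⟨D, -, ⟨e, heD⟩, hD⟩ := h.exists_isOpen_isInwardAt hO (interior_subset hx)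
  obtain ⟨r, hr, hin⟩ := (hD e heD).2
  have hback : Tendsto (fun t : ℝ ↦ x - t • e) (𝓝[>] 0) (𝓝 x) := by
    have : Continuous fun t : ℝ ↦ x - t • e := by fun_prop
    simpa using (this.tendsto 0).mono_left (nhdsWithin_le_nhds (s := Ioi 0))
  obtain ⟨t, ⟨htcl, htx⟩, ht⟩ := ((hback.eventually (inter_mem
    (isOpen_interior.mem_nhds hx) (Metric.ball_mem_nhds x hr))).and (Ioo_mem_nhdsGT hr)).exists
  simpa using hin (x - t • e) (interior_subset htcl) htx t ht

theorem exists_cross_ne_zero_of_isOpen {g : Plane} (hg : g ≠ 0) {D : Set Plane} (hD : IsOpen D)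
    (hne : D.Nonempty) : ∃ e ∈ D, cross g e ≠ 0 := by
  by_contra! hzero
  let S : Submodule ℝ Plane :=
    { carrier := {e | cross g e = 0}
      add_mem' := fun {a b} ha hb ↦ by
        simp only [mem_ofPred_eq, cross, PiLp.add_apply] at *
        linear_combination ha + hb
      zero_mem' := by simp [cross]
      smul_mem' := fun c a ha ↦ by
        simp only [mem_ofPred_eq, cross, PiLp.smul_apply, smul_eq_mul] at *
        linear_combination c * ha }
  have hS : S = ⊤ := Submodule.eq_top_of_nonempty_interior' S
    (hne.mono (interior_maximal hzero hD))
  have hperp : cross g !₂[-g 1, g 0] = 0 := (hS ▸ Submodule.mem_top : !₂[-g 1, g 0] ∈ S)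
  have hsq : ‖g‖ ^ 2 = 0 := by
    rw [EuclideanSpace.real_norm_sq_eq, Fin.sum_univ_two, ← hperp]
    simp [cross]
    ring
  exact hg (by simpa using hsq)

theorem HasLipschitzBoundary.exists_uniform_transversal (h : HasLipschitzBoundary Ω)
    (hO : IsOpen Ω) (hb : Bornology.IsBounded Ω) :
    ∃ η > 0, ∀ x ∈ closure Ω, ∀ g : Plane, ‖g‖ = 1 → ∃ e : Plane, ‖e‖ ≤ 1 ∧ η ≤ |cross g e| ∧
      ∀ y ∈ closure Ω, dist y x < η → ∀ t ∈ Ioo 0 η, y + t • e ∈ Ω := by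
  have hK : IsCompact (closure Ω ×ˢ Metric.sphere (0 : Plane) 1) :=
    hb.isCompact_closure.prod (isCompact_sphere _ _)
  have hη : ∀ᶠ η : ℝ in 𝓝 0, ∀ z ∈ closure Ω ×ˢ Metric.sphere (0 : Plane) 1,
      ∃ e : Plane, ‖e‖ ≤ 1 ∧ η ≤ |cross z.2 e| ∧
        ∀ y ∈ closure Ω, dist y z.1 < η → ∀ t ∈ Ioo 0 η, y + t • e ∈ Ω := by
    refine hK.eventually_forall_of_forall_eventually ?_
    rintro ⟨x, g⟩ ⟨hx, hg⟩
    obtain ⟨D, hDo, hDne, hD⟩ := h.exists_isOpen_isInwardAt hO hx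
    obtain ⟨e, heD, hcross⟩ :=
      exists_cross_ne_zero_of_isOpen (ne_zero_of_mem_unit_sphere ⟨g, hg⟩) hDo hDne
    obtain ⟨he, r, hr, hin⟩ := hD e heD
    have hopen : IsOpen {q : ℝ × Plane × Plane |
        q.1 < r / 2 ∧ dist q.2.1 x < r / 2 ∧ q.1 < |cross q.2.2 e|} := by
      unfold cross
      refine .and ?_ (.and ?_ ?_) <;> exact isOpen_lt (by fun_prop) (by fun_prop)
    filter_upwards [hopen.mem_nhds (by simp [hr, hcross])] with q ⟨hqr, hqx, hqe⟩
    refine ⟨e, he, hqe.le, fun y hy hyq t ht ↦ hin y hy ?_ t ⟨ht.1, by linarith [ht.2]⟩⟩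
    linarith [dist_triangle y q.2.1 x]
  obtain ⟨η, hη, hpos⟩ :=
    ((hη.filter_mono nhdsWithin_le_nhds).and (self_mem_nhdsWithin (s := Ioi (0 : ℝ)))).exists
  exact ⟨η, hpos, fun x hx g hg ↦ hη (x, g) ⟨hx, mem_sphere_zero_iff_norm.2 hg⟩⟩

end LipschitzBoundary

section Triangulations

theorem mem_convexHull_triple {E : Type*} [AddCommGroup E] [Module ℝ E] {A B C : E} {α β γ : ℝ}
    (hα : 0 ≤ α) (hβ : 0 ≤ β) (hγ : 0 ≤ γ) (hsum : α + β + γ = 1) :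
    α • A + β • B + γ • C ∈ convexHull ℝ {A, B, C} := by
  have := (convex_convexHull ℝ ({A, B, C} : Set E)).sum_mem (t := Finset.univ)
    (w := ![α, β, γ]) (z := ![A, B, C])
    (by intro i _; fin_cases i <;> simpa) (by simpa [Fin.sum_univ_three] using hsum)
    (by intro i _; fin_cases i <;> exact subset_convexHull ℝ _ (by simp))
  simpa [Fin.sum_univ_three] using this

theorem hasFDerivAt_of_eqOn_affine {E : Type*} [NormedAddCommGroup E] [NormedSpace ℝ E]
    [FiniteDimensional ℝ E] {U : E → ℝ} {D : Set E} {l : E →ₗ[ℝ] ℝ} {c : ℝ}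
    (hU : ∀ x ∈ D, U x = l x + c) {x : E} (hx : D ∈ 𝓝 x) :
    HasFDerivAt U (LinearMap.toContinuousLinearMap l) x := by
  refine ((LinearMap.toContinuousLinearMap l).hasFDerivAt.add_const c).congr_of_eventuallyEq ?_
  filter_upwards [hx] with y hy
  simpa using hU y hy

theorem enorm_apply_le_enorm_gradient {U : Plane → ℝ} {D : Set Plane} {l : Plane →ₗ[ℝ] ℝ} {c : ℝ}
    (hU : ∀ x ∈ D, U x = l x + c) {x : Plane} (hx : D ∈ 𝓝 x) {n : Plane} (hn : ‖n‖ ≤ 1) :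
    ‖l n‖ₑ ≤ ‖gradient U x‖ₑ := by
  rw [enorm_gradient, (hasFDerivAt_of_eqOn_affine hU hx).fderiv, ← ofReal_norm, ← ofReal_norm]
  exact ENNReal.ofReal_le_ofReal
    ((LinearMap.toContinuousLinearMap l).unit_le_opNorm n hn)

theorem ae_mem_nhds_of_convex {E : Type*} [NormedAddCommGroup E] [NormedSpace ℝ E]
    [MeasurableSpace E] [BorelSpace E] [FiniteDimensional ℝ E] (μ : Measure E) [μ.IsAddHaarMeasure]
    {D : Set E} (hD : Convex ℝ D) : ∀ᵐ x ∂μ, x ∈ D → D ∈ 𝓝 x := by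
  filter_upwards [measure_eq_zero_iff_ae_notMem.1 (hD.addHaar_frontier μ)] with x hx hxD
  rw [← mem_interior_iff_mem_nhds]
  by_contra h
  exact hx ⟨subset_closure hxD, h⟩

theorem eventually_cofinite_affine_ne_zero {α β γ : ℝ} (h : β ≠ 0 ∨ γ ≠ 0) :
    ∀ᶠ s : ℝ in cofinite, ∀ᶠ t : ℝ in cofinite, α + s * β + t * γ ≠ 0 := by
  by_cases hγ : γ = 0
  · have hβ : β ≠ 0 := h.resolve_right (not_not.2 hγ)
    filter_upwards [(finite_singleton (-α / β)).compl_mem_cofinite] with s hs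
    refine .of_forall fun t h0 ↦ hs ?_
    rw [mem_singleton_iff, eq_div_iff hβ]
    rw [hγ] at h0
    linarith
  · refine .of_forall fun s ↦ ?_
    filter_upwards [(finite_singleton (-(α + s * β) / γ)).compl_mem_cofinite] with t ht h0
    refine ht ?_
    rw [mem_singleton_iff, eq_div_iff hγ]
    linarith

theorem eq_smul_add_smul_of_cross_ne_zero {g e : Plane} (hd : cross g e ≠ 0) (x : Plane) :
    x = (cross x e / cross g e) • g + (cross g x / cross g e) • e := by
  ext i
  simp only [cross] at *
  fin_cases i <;> simp only [Fin.zero_eta, Fin.mk_one, PiLp.add_apply, PiLp.smul_apply,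
    smul_eq_mul] <;> rw [div_mul_eq_mul_div, div_mul_eq_mul_div, ← add_div, eq_div_iff hd] <;> ring

theorem eventually_cofinite_affineMap_ne_zero {f : Plane →ᵃ[ℝ] ℝ} (hf : f.linear ≠ 0) (p : Plane)
    {g e : Plane} (hd : cross g e ≠ 0) :
    ∀ᶠ s : ℝ in cofinite, ∀ᶠ t : ℝ in cofinite, f (p + s • g + t • e) ≠ 0 := by
  have hne : f.linear g ≠ 0 ∨ f.linear e ≠ 0 := by
    by_contra! h
    refine hf (LinearMap.ext fun x ↦ ?_)
    rw [eq_smul_add_smul_of_cross_ne_zero hd x]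
    simp [h]
  have happly (s t : ℝ) : f (p + s • g + t • e) = f p + s * f.linear g + t * f.linear e := by
    rw [add_comm (p + s • g), add_comm p, ← vadd_eq_add, f.map_vadd, ← vadd_eq_add, f.map_vadd]
    simp only [map_smul, smul_eq_mul, vadd_eq_add]
    ring
  simpa only [happly] using eventually_cofinite_affine_ne_zero hne

namespace Triangulation

variable {Ω : Set Plane} (T : Triangulation Ω)

theorem convexHull_subset_closure {K : Set Plane} (hK : K ∈ T.elements) :
    convexHull ℝ K ⊆ closure Ω := by
  rw [← T.cover]
  exact subset_biUnion_of_mem (u := fun K ↦ convexHull ℝ K) hK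

theorem isBounded (T : Triangulation Ω) : Bornology.IsBounded Ω := by
  refine Bornology.IsBounded.subset ?_ subset_closure
  rw [← T.cover, Bornology.isBounded_biUnion T.finite]
  intro K hK
  have hfin : K.Finite := finite_of_ncard_ne_zero (by rw [T.ncard_eq K hK]; norm_num)
  exact isBounded_convexHull.2 hfin.isBounded

theorem exists_affineBasis {K : Set Plane} (hK : K ∈ T.elements) :
    ∃ b : AffineBasis K ℝ Plane, range b = K := by
  have hcard : Nat.card K = 3 := T.ncard_eq K hK
  have : Finite K := Nat.finite_of_card_ne_zero (by omega)
  have := Fintype.ofFinite K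
  refine ⟨⟨(↑), T.indep K hK, ?_⟩, Subtype.range_coe⟩
  rw [(T.indep K hK).affineSpan_eq_top_iff_card_eq_finrank_add_one, ← Nat.card_eq_fintype_card,
    hcard, finrank_euclideanSpace_fin]

theorem eventually_cofinite_mem_nhds (p : Plane) {g e : Plane} (hd : cross g e ≠ 0) :
    ∀ᶠ s : ℝ in cofinite, ∀ᶠ t : ℝ in cofinite, ∀ K ∈ T.elements,
      p + s • g + t • e ∈ convexHull ℝ K → convexHull ℝ K ∈ 𝓝 (p + s • g + t • e) := by
  have hK (K) (hK : K ∈ T.elements) : ∀ᶠ s : ℝ in cofinite, ∀ᶠ t : ℝ in cofinite,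
      p + s • g + t • e ∈ convexHull ℝ K → convexHull ℝ K ∈ 𝓝 (p + s • g + t • e) := by
    obtain ⟨b, hb⟩ := T.exists_affineBasis hK
    have : Finite K := finite_of_ncard_ne_zero (by rw [T.ncard_eq K hK]; norm_num)
    have : Nontrivial K := by
      rw [← Finite.one_lt_card_iff_nontrivial, Nat.card_coe_set_eq, T.ncard_eq K hK]
      norm_num
    have hcoord (i) : (b.coord i).linear ≠ 0 := fun h0 ↦ by
      obtain ⟨v, hv⟩ := (b.coord i).linear_surjective_iff.2 (b.surjective_coord i) 1
      rw [h0, LinearMap.zero_apply] at hv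
      exact zero_ne_one hv
    have hne := eventually_all.2 fun i ↦
      eventually_cofinite_affineMap_ne_zero (hcoord i) p hd
    filter_upwards [hne] with s hs
    filter_upwards [eventually_all.2 hs] with t ht hx
    rw [← hb] at hx ⊢
    rw [← mem_interior_iff_mem_nhds, b.interior_convexHull]
    rw [b.convexHull_eq_nonneg_coord] at hx
    exact fun i ↦ lt_of_le_of_ne (hx i) (ht i).symm
  filter_upwards [(eventually_all_finite T.finite).2 hK] with s hs
  exact (eventually_all_finite T.finite).2 hs

theorem ae_mem_nhds : ∀ᵐ x, ∀ K ∈ T.elements, x ∈ convexHull ℝ K → convexHull ℝ K ∈ 𝓝 x :=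
  (ae_ball_iff T.finite.countable).2 fun K _ ↦
    ae_mem_nhds_of_convex volume (convex_convexHull ℝ K)

variable {T}

theorem differentiableAt_of_mem_femSpace {U : Plane → ℝ} (hU : U ∈ T.femSpace) {x : Plane}
    (hx : x ∈ closure Ω) (hnhds : ∀ K ∈ T.elements, x ∈ convexHull ℝ K → convexHull ℝ K ∈ 𝓝 x) :
    DifferentiableAt ℝ U x := by
  rw [← T.cover] at hx
  obtain ⟨K, hK, hxK⟩ := mem_iUnion₂.1 hx
  obtain ⟨l, c, hlc⟩ := hU.2 K hK
  exact (hasFDerivAt_of_eqOn_affine hlc (hnhds K hK hxK)).differentiableAt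

theorem IsFEMSolution.mem_femSpace {f g U : Plane → ℝ} (hU : T.IsFEMSolution f g U)
    (hg : g ∈ T.femSpace) : U ∈ T.femSpace := by
  obtain ⟨⟨U₀, ⟨hU₀, -⟩, hsum⟩, -⟩ := hU
  refine ⟨(hU₀.1.add hg.1).congr fun x _ ↦ hsum x, fun K hK ↦ ?_⟩
  obtain ⟨l, c, hlc⟩ := hU₀.2 K hK
  obtain ⟨l', c', hlc'⟩ := hg.2 K hK
  refine ⟨l + l', c + c', fun x hx ↦ ?_⟩
  rw [hsum, hlc x hx, hlc' x hx, LinearMap.add_apply]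
  ring

end Triangulation

theorem h1Seminorm_sub_le {Ω : Set Plane} {v w : Plane → ℝ}
    (hv : ∀ᵐ x ∂volume.restrict Ω, DifferentiableAt ℝ v x)
    (hw : ∀ᵐ x ∂volume.restrict Ω, DifferentiableAt ℝ w x) :
    h1Seminorm Ω (fun x ↦ v x - w x) ≤ h1Seminorm Ω v + h1Seminorm Ω w := by
  have hgrad : gradient (fun x ↦ v x - w x) =ᵐ[volume.restrict Ω] gradient v - gradient w := by
    filter_upwards [hv, hw] with x hvx hwx
    simp only [gradient, Pi.sub_apply, fderiv_fun_sub hvx hwx, map_sub]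
  rw [h1Seminorm, eLpNorm_congr_ae hgrad]
  exact eLpNorm_sub_le (measurable_gradient v).aestronglyMeasurable
    (measurable_gradient w).aestronglyMeasurable one_le_two

theorem quadSol_eq_norm_sq (x : Plane) : quadSol x = ‖x‖ ^ 2 := by
  rw [EuclideanSpace.real_norm_sq_eq, Fin.sum_univ_two, quadSol]

theorem hasGradientAt_quadSol (x : Plane) : HasGradientAt quadSol ((2 : ℝ) • x) x := by
  rw [funext quadSol_eq_norm_sq, hasGradientAt_iff_hasFDerivAt]
  refine (hasStrictFDerivAt_norm_sq x).hasFDerivAt.congr_fderiv ?_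
  ext y
  simp

theorem differentiable_quadSol : Differentiable ℝ quadSol :=
  fun x ↦ (hasGradientAt_quadSol x).differentiableAt

theorem h1Seminorm_quadSol_lt_top {Ω : Set Plane} (hΩ : MeasurableSet Ω)
    (hb : Bornology.IsBounded Ω) : h1Seminorm Ω quadSol < ∞ := by
  obtain ⟨R, hR⟩ := hb.exists_norm_le
  have : IsFiniteMeasure (volume.restrict Ω) := isFiniteMeasure_restrict.2 hb.measure_lt_top.ne
  refine (MemLp.of_bound (measurable_gradient quadSol).aestronglyMeasurable (2 * R) ?_).2
  filter_upwards [ae_restrict_mem hΩ] with x hx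
  rw [(hasGradientAt_quadSol x).gradient, norm_smul, Real.norm_two]
  gcongr
  exact hR x hx

theorem Triangulation.h1Seminorm_le_add {Ω : Set Plane} {T : Triangulation Ω} {U : Plane → ℝ}
    (hΩ : MeasurableSet Ω) (hU : U ∈ T.femSpace) :
    h1Seminorm Ω U ≤ h1Seminorm Ω quadSol + h1Seminorm Ω (fun x ↦ quadSol x - U x) := by
  have hdiff : ∀ᵐ x ∂volume.restrict Ω, DifferentiableAt ℝ U x := by
    filter_upwards [ae_restrict_mem hΩ, ae_restrict_of_ae T.ae_mem_nhds] with x hx hnhds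
    exact differentiableAt_of_mem_femSpace hU (subset_closure hx) hnhds
  have h := h1Seminorm_sub_le (w := fun x ↦ quadSol x - U x)
    (.of_forall fun x ↦ differentiable_quadSol x)
    (hdiff.mono fun x hx ↦ (differentiable_quadSol x).sub hx)
  simpa only [sub_sub_cancel] using h

end Triangulations

section ZigzagBand

/-- The vertices of a band in the order in which its zigzag of legs visits them: those with even
index lie on the edge of direction `g`, those with odd index at distance `hbar` from it. -/
noncomputable def zigzag (a g n : Plane) (h hbar : ℝ) (j : ℕ) : Plane :=
  a + (j * (h / 2)) • g + (if Even j then 0 else hbar) • n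

/-- The vertex set of the `j`-th triangle of a band. The triangles `K₀, K̃₁, K₁, …, K̃_N, K_N`
carry the numbers `0, 1, …, 2 N`, and consecutive ones share a leg. -/
noncomputable def zigzagTriangle (a g n : Plane) (h hbar : ℝ) (j : ℕ) : Set Plane :=
  {zigzag a g n h hbar j, zigzag a g n h hbar (j + 1), zigzag a g n h hbar (j + 2)}

/-- A rectangle that lies, in the chart `planeChart a g n`, inside the `j`-th triangle of a band and
makes up a fixed fraction of its area. -/
def zigzagBox (h hbar : ℝ) (j : ℕ) : Set (ℝ × ℝ) :=
  Ioo ((j / 2 + 1 / 3) * h) ((j / 2 + 2 / 3) * h) ×ˢ Ioo (hbar / 3) (2 * hbar / 3)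

/-- `Triangulation.ContainsBand` with explicit position and with the triangles numbered
consecutively. -/
structure Triangulation.IsZigzagBand {Ω : Set Plane} (T : Triangulation Ω) (a g n : Plane)
    (h hbar : ℝ) (N : ℕ) : Prop where
  norm_tangent : ‖g‖ = 1
  norm_normal : ‖n‖ = 1
  inner_eq_zero : inner ℝ g n = 0
  mem_elements : ∀ j ≤ 2 * N, zigzagTriangle a g n h hbar j ∈ T.elements

variable {a g n : Plane} {h hbar : ℝ} {N : ℕ}

theorem zigzag_two_mul (a g n : Plane) (h hbar : ℝ) (i : ℕ) :
    zigzag a g n h hbar (2 * i) = a + (i * h) • g := by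
  simp only [zigzag, even_two_mul, if_true, zero_smul, add_zero]
  push_cast
  congr 2
  ring

theorem zigzag_two_mul_add_one (a g n : Plane) (h hbar : ℝ) (i : ℕ) :
    zigzag a g n h hbar (2 * i + 1) = a + ((i + 1 / 2) * h) • g + hbar • n := by
  simp only [zigzag, Nat.not_even_two_mul_add_one, if_false]
  push_cast
  congr 3
  ring

theorem planeChart_mem_convexHull_zigzagTriangle (hh : 0 < h) (hb : 0 < hbar) {j : ℕ} {z : ℝ × ℝ}
    (hz : z ∈ zigzagBox h hbar j) :
    planeChart a g n z ∈ convexHull ℝ (zigzagTriangle a g n h hbar j) := by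
  obtain ⟨⟨hs₁, hs₂⟩, ht₁, ht₂⟩ := hz
  obtain ⟨σ, hσ⟩ : ∃ σ, z.1 = σ * h := ⟨z.1 / h, by field_simp⟩
  obtain ⟨θ, hθ⟩ : ∃ θ, z.2 = θ * hbar := ⟨z.2 / hbar, by field_simp⟩
  rw [hσ] at hs₁ hs₂
  rw [hθ] at ht₁ ht₂
  have hσ₁ := lt_of_mul_lt_mul_right hs₁ hh.le
  have hσ₂ := lt_of_mul_lt_mul_right hs₂ hh.le
  have hθ₁ : 1 / 3 < θ := by nlinarith
  have hθ₂ : θ < 2 / 3 := by nlinarith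
  rw [planeChart, hσ, hθ, zigzagTriangle]
  obtain hj | hj := Nat.even_or_odd j
  · convert mem_convexHull_triple (A := zigzag a g n h hbar j) (B := zigzag a g n h hbar (j + 1))
      (C := zigzag a g n h hbar (j + 2)) (α := 1 - (σ - j / 2) - θ / 2) (β := θ)
      (γ := σ - j / 2 - θ / 2) (by linarith) (by linarith) (by linarith) (by ring) using 1
    simp only [zigzag, hj, Nat.even_add_one, not_true_eq_false, not_false_eq_true, if_true,
      if_false]
    push_cast
    module
  · have hj' := Nat.not_even_iff_odd.2 hj
    convert mem_convexHull_triple (A := zigzag a g n h hbar j) (B := zigzag a g n h hbar (j + 1))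
      (C := zigzag a g n h hbar (j + 2)) (α := 1 - (σ - j / 2) - (1 - θ) / 2) (β := 1 - θ)
      (γ := σ - j / 2 - (1 - θ) / 2) (by linarith) (by linarith) (by linarith) (by ring) using 1
    simp only [zigzag, hj', Nat.even_add_one, not_true_eq_false, not_false_eq_true, if_true,
      if_false]
    push_cast
    module

theorem volume_zigzagBox (hh : 0 ≤ h) (hbar : ℝ) (j : ℕ) :
    volume (zigzagBox h hbar j) = ENNReal.ofReal (h * hbar / 9) := by
  rw [zigzagBox, Measure.volume_eq_prod, Measure.prod_prod, Real.volume_Ioo, Real.volume_Ioo,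
    ← ENNReal.ofReal_mul (by linarith)]
  congr 1
  ring

theorem pairwise_disjoint_zigzagBox (hh : 0 ≤ h) (hbar : ℝ) :
    Pairwise (Function.onFun Disjoint (zigzagBox h hbar)) := by
  refine (pairwise_disjoint_on _).2 fun i j hij ↦ disjoint_left.2 fun z hzi hzj ↦ ?_
  have hij' : (i : ℝ) + 1 ≤ j := by exact_mod_cast hij
  have : ((i : ℝ) / 2 + 2 / 3) * h ≤ (j / 2 + 1 / 3) * h := by gcongr ?_ * h; linarith
  linarith [hzi.1.2, hzj.1.1]

theorem mem_convexHull_zigzagTriangle_two_mul (n : Plane) (hh : 0 < h) (hbar : ℝ) {i : ℕ} {s : ℝ}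
    (hs : s ∈ Icc (i * h) ((i + 1) * h)) :
    a + s • g ∈ convexHull ℝ (zigzagTriangle a g n h hbar (2 * i)) := by
  obtain ⟨σ, rfl⟩ : ∃ σ, s = σ * h := ⟨s / h, by field_simp⟩
  have hσ₁ := le_of_mul_le_mul_right hs.1 hh
  have hσ₂ := le_of_mul_le_mul_right hs.2 hh
  rw [zigzagTriangle]
  convert mem_convexHull_triple (A := zigzag a g n h hbar (2 * i))
    (B := zigzag a g n h hbar (2 * i + 1)) (C := zigzag a g n h hbar (2 * i + 2))
    (α := 1 - (σ - i)) (β := 0) (γ := σ - i) (by linarith) le_rfl (by linarith) (by ring) using 1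
  rw [zigzag_two_mul, ← mul_add_one, zigzag_two_mul]
  push_cast
  module

theorem exists_mem_Ico_mul (hh : 0 < h) {s : ℝ} (hs : s ∈ Ico 0 ((N + 1) * h)) :
    ∃ i ≤ N, s ∈ Ico (i * h) ((i + 1) * h) := by
  refine ⟨⌊s / h⌋₊, ?_, ?_, ?_⟩
  · refine Nat.lt_succ_iff.1 ((Nat.floor_lt (div_nonneg hs.1 hh.le)).2 ?_)
    rw [div_lt_iff₀ hh]
    exact_mod_cast hs.2
  · rw [← le_div_iff₀ hh]
    exact Nat.floor_le (div_nonneg hs.1 hh.le)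
  · rw [← div_lt_iff₀ hh]
    exact Nat.lt_floor_add_one _

theorem abs_sub_sub_le_of_piecewise_affine {f : ℝ → ℝ} (hh : 0 < h) {t ε : ℝ}
    (hc : ContinuousOn f (Icc 0 ((N + 1) * h)))
    (hf : ∀ i ≤ N, ∃ m b : ℝ, |m - t| ≤ ε ∧ ∀ s ∈ Icc (i * h) ((i + 1) * h), f s = m * s + b)
    {s s' : ℝ} (hs : 0 ≤ s) (hss' : s ≤ s') (hs' : s' ≤ (N + 1) * h) :
    |f s' - f s - t * (s' - s)| ≤ ε * (s' - s) := by
  have hcont : ContinuousOn (fun r ↦ f r - t * r) (Icc s s') :=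
    (hc.mono (Icc_subset_Icc hs hs')).sub (by fun_prop)
  have hder : ∀ r ∈ Ico s s', ∃ d, |d| ≤ ε ∧
      HasDerivWithinAt (fun r ↦ f r - t * r) d (Ici r) r := by
    intro r hr
    obtain ⟨i, hi, hri⟩ := exists_mem_Ico_mul hh ⟨hs.trans hr.1, hr.2.trans_le hs'⟩
    obtain ⟨m, b, hm, hmb⟩ := hf i hi
    have heq : EqOn (fun r ↦ f r - t * r) (fun r ↦ (m - t) * r + b) (Icc (i * h) ((i + 1) * h)) :=
      fun x hx ↦ by simp only [hmb x hx]; ring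
    have hderiv : HasDerivAt (fun r ↦ (m - t) * r + b) (m - t) r := by
      simpa using ((hasDerivAt_id r).const_mul (m - t)).add_const b
    refine ⟨m - t, hm, hderiv.hasDerivWithinAt.congr_of_eventuallyEq ?_
      (heq (Ico_subset_Icc_self hri))⟩
    filter_upwards [Ico_mem_nhdsGE hri.2] with x hx using heq ⟨hri.1.trans hx.1, hx.2.le⟩
  choose! d hd hder using hder
  have := norm_image_sub_le_of_norm_deriv_right_le_segment hcont hder hd s' ⟨hss', le_rfl⟩
  rw [Real.norm_eq_abs] at this
  convert this using 2
  ring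

theorem abs_apply_sub_apply_le {E : Type*} [AddCommGroup E] [Module ℝ E] {l l' : E →ₗ[ℝ] ℝ}
    {g n : E} {p r : ℝ} (hp : 0 < p) (h : l (p • g + r • n) = l' (p • g + r • n)) :
    |l' g - l g| ≤ |r| / p * (|l n| + |l' n|) := by
  simp only [map_add, map_smul, smul_eq_mul] at h
  have heq : l' g - l g = r / p * (l n - l' n) := by
    field_simp
    linarith
  rw [heq, abs_mul, abs_div, abs_of_pos hp]
  gcongr
  exact abs_sub _ _

theorem abs_sub_le_mul_sum_of_abs_sub_succ_le {u v : ℕ → ℝ} {C : ℝ} (hC : 0 ≤ C) {m : ℕ}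
    (huv : ∀ j < m, |u (j + 1) - u j| ≤ C * (|v j| + |v (j + 1)|)) {k : ℕ} (hk : k ≤ m) :
    |u k - u 0| ≤ 2 * C * ∑ j ∈ Finset.range (m + 1), |v j| := by
  have htel : |u k - u 0| ≤ ∑ j ∈ Finset.range k, |u (j + 1) - u j| := by
    rw [← Real.dist_eq, dist_comm]
    refine (dist_le_range_sum_dist u k).trans_eq (Finset.sum_congr rfl fun j _ ↦ ?_)
    rw [dist_comm, Real.dist_eq]
  have hfst : ∑ j ∈ Finset.range k, |v j| ≤ ∑ j ∈ Finset.range (m + 1), |v j| := by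
    gcongr
    omega
  have hsnd : ∑ j ∈ Finset.range k, |v (j + 1)| ≤ ∑ j ∈ Finset.range (m + 1), |v j| := by
    have : ∑ j ∈ Finset.range (k + 1), |v j| ≤ ∑ j ∈ Finset.range (m + 1), |v j| := by
      gcongr
    rw [Finset.sum_range_succ'] at this
    linarith [abs_nonneg (v 0)]
  calc |u k - u 0| ≤ ∑ j ∈ Finset.range k, C * (|v j| + |v (j + 1)|) :=
        htel.trans (Finset.sum_le_sum fun j hj ↦ huv j ((Finset.mem_range.1 hj).trans_le hk))
    _ = C * (∑ j ∈ Finset.range k, |v j| + ∑ j ∈ Finset.range k, |v (j + 1)|) := by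
        rw [← Finset.mul_sum, Finset.sum_add_distrib]
    _ ≤ C * (∑ j ∈ Finset.range (m + 1), |v j| + ∑ j ∈ Finset.range (m + 1), |v j|) := by gcongr
    _ = 2 * C * ∑ j ∈ Finset.range (m + 1), |v j| := by ring

theorem abs_tangential_slope_sub_le (hh : 0 < h) (hb : 0 < hbar) {U : Plane → ℝ} {j : ℕ}
    {l l' : Plane →ₗ[ℝ] ℝ} {c c' : ℝ}
    (hl : ∀ x ∈ convexHull ℝ (zigzagTriangle a g n h hbar j), U x = l x + c)
    (hl' : ∀ x ∈ convexHull ℝ (zigzagTriangle a g n h hbar (j + 1)), U x = l' x + c') :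
    |l' g - l g| ≤ 2 * hbar / h * (|l n| + |l' n|) := by
  have hagree {x : Plane} (hx : x ∈ zigzagTriangle a g n h hbar j)
      (hx' : x ∈ zigzagTriangle a g n h hbar (j + 1)) : l x + c = l' x + c' := by
    rw [← hl x (subset_convexHull ℝ _ hx), ← hl' x (subset_convexHull ℝ _ hx')]
  have hx := hagree (x := zigzag a g n h hbar (j + 1)) (by simp [zigzagTriangle])
    (by simp [zigzagTriangle])
  have hy := hagree (x := zigzag a g n h hbar (j + 2)) (by simp [zigzagTriangle])
    (by simp [zigzagTriangle])
  obtain ⟨r, hr, hleg⟩ : ∃ r : ℝ, |r| = hbar ∧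
      zigzag a g n h hbar (j + 2) - zigzag a g n h hbar (j + 1) = (h / 2) • g + r • n := by
    obtain heven | hodd := Nat.even_or_odd j
    · refine ⟨-hbar, by rw [abs_neg, abs_of_pos hb], ?_⟩
      simp only [zigzag, heven, Nat.even_add_one, not_true_eq_false, not_false_eq_true, if_true,
        if_false]
      push_cast
      module
    · refine ⟨hbar, abs_of_pos hb, ?_⟩
      simp only [zigzag, Nat.not_even_iff_odd.2 hodd, Nat.even_add_one, not_true_eq_false,
        not_false_eq_true, if_true, if_false]
      push_cast
      module
  have hslope := abs_apply_sub_apply_le (l := l) (l' := l') (g := g) (n := n)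
    (half_pos hh) (r := r) (by rw [← hleg, map_sub, map_sub]; linarith)
  rw [hr] at hslope
  convert hslope using 2
  field_simp

namespace Triangulation

variable {Ω : Set Plane} {T : Triangulation Ω} {U : Plane → ℝ}

theorem ContainsBand.exists_isZigzagBand (hT : T.ContainsBand h hbar N) :
    ∃ a g n, T.IsZigzagBand a g n h hbar N := by
  obtain ⟨a, g, n, hg, hn, hgn, P, Q, hP, hQ, hK, hK'⟩ := hT
  obtain rfl : P = fun i ↦ zigzag a g n h hbar (2 * i) :=
    funext fun i ↦ (hP i).trans (zigzag_two_mul a g n h hbar i).symm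
  obtain rfl : Q = fun i ↦ zigzag a g n h hbar (2 * i + 1) :=
    funext fun i ↦ (hQ i).trans (zigzag_two_mul_add_one a g n h hbar i).symm
  refine ⟨a, g, n, hg, hn, hgn, fun j hj ↦ ?_⟩
  obtain ⟨i, rfl | rfl⟩ := j.even_or_odd'
  · rw [zigzagTriangle, Set.pair_comm]
    exact hK i (by omega)
  · rw [zigzagTriangle, Set.pair_comm]
    exact hK' i (by omega)

namespace IsZigzagBand

theorem edge_mem_closure (hT : T.IsZigzagBand a g n h hbar N) (hh : 0 < h) {s : ℝ}
    (hs : s ∈ Icc 0 ((N + 1) * h)) : a + s • g ∈ closure Ω := by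
  have hmem {i : ℕ} (hi : i ≤ N) (hsi : s ∈ Icc (i * h) ((i + 1) * h)) : a + s • g ∈ closure Ω :=
    T.convexHull_subset_closure (hT.mem_elements (2 * i) (by omega))
      (mem_convexHull_zigzagTriangle_two_mul n hh hbar hsi)
  obtain hlt | heq := hs.2.lt_or_eq
  · obtain ⟨i, hi, hsi⟩ := exists_mem_Ico_mul hh ⟨hs.1, hlt⟩
    exact hmem hi (Ico_subset_Icc_self hsi)
  · exact hmem le_rfl ⟨by rw [heq]; gcongr; linarith, heq.le⟩

theorem length_le_diam (hT : T.IsZigzagBand a g n h hbar N) (hh : 0 < h) :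
    (N + 1) * h ≤ Metric.diam (closure Ω) := by
  have hdist : dist (a + ((N + 1) * h) • g) (a + (0 : ℝ) • g) = (N + 1) * h := by
    rw [dist_eq_norm, zero_smul, add_zero, add_sub_cancel_left, norm_smul, hT.norm_tangent, mul_one,
      Real.norm_of_nonneg (by positivity)]
  rw [← hdist]
  exact Metric.dist_le_diam_of_mem T.isBounded.closure
    (hT.edge_mem_closure hh ⟨by positivity, le_rfl⟩)
    (hT.edge_mem_closure hh ⟨le_rfl, by positivity⟩)

theorem cross_ne_zero (hT : T.IsZigzagBand a g n h hbar N) : cross g n ≠ 0 := by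
  rw [← abs_pos, abs_cross_eq_one hT.norm_tangent hT.norm_normal hT.inner_eq_zero]
  exact one_pos

theorem ae_convexHull_zigzagTriangle_mem_nhds (hT : T.IsZigzagBand a g n h hbar N) (hh : 0 < h)
    (hb : 0 < hbar) : ∀ᵐ z, ∀ j ≤ 2 * N, z ∈ zigzagBox h hbar j →
      convexHull ℝ (zigzagTriangle a g n h hbar j) ∈ 𝓝 (planeChart a g n z) := by
  filter_upwards [ae_planeChart a hT.cross_ne_zero T.ae_mem_nhds] with z hz j hj hzj
  exact hz _ (hT.mem_elements j hj) (planeChart_mem_convexHull_zigzagTriangle hh hb hzj)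

theorem sum_enorm_normal_slope_sq_le (hT : T.IsZigzagBand a g n h hbar N) (hh : 0 < h)
    (hb : 0 < hbar) (hΩ : MeasurableSet Ω) (hint : interior (closure Ω) ⊆ Ω)
    {l : ℕ → Plane →ₗ[ℝ] ℝ} {c : ℕ → ℝ}
    (hl : ∀ j ≤ 2 * N, ∀ x ∈ convexHull ℝ (zigzagTriangle a g n h hbar j), U x = l j x + c j) :
    (∑ j ∈ Finset.range (2 * N + 1), ‖l j n‖ₑ ^ 2) * ENNReal.ofReal (h * hbar / 9) ≤
      h1Seminorm Ω U ^ 2 := by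
  have hnhds := hT.ae_convexHull_zigzagTriangle_mem_nhds hh hb
  calc (∑ j ∈ Finset.range (2 * N + 1), ‖l j n‖ₑ ^ 2) * ENNReal.ofReal (h * hbar / 9)
      = ∑ j ∈ Finset.range (2 * N + 1), ∫⁻ _z in zigzagBox h hbar j, ‖l j n‖ₑ ^ 2 := by
        simp only [Finset.sum_mul, setLIntegral_const, volume_zigzagBox hh.le]
    _ ≤ ∑ j ∈ Finset.range (2 * N + 1),
          ∫⁻ z in zigzagBox h hbar j, ‖gradient U (planeChart a g n z)‖ₑ ^ 2 := by
        refine Finset.sum_le_sum fun j hj ↦ setLIntegral_mono_ae' ?_ ?_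
        · exact measurableSet_Ioo.prod measurableSet_Ioo
        · have hj' : j ≤ 2 * N := Nat.lt_succ_iff.1 (Finset.mem_range.1 hj)
          filter_upwards [hnhds] with z hz hzj
          gcongr
          exact enorm_apply_le_enorm_gradient (hl j hj') (hz j hj' hzj) hT.norm_normal.le
    _ = ∫⁻ z in ⋃ j ∈ Finset.range (2 * N + 1), zigzagBox h hbar j,
          ‖gradient U (planeChart a g n z)‖ₑ ^ 2 :=
        (lintegral_biUnion_finset (fun i _ j _ hij ↦ pairwise_disjoint_zigzagBox hh.le hbar hij)
          (fun j _ ↦ measurableSet_Ioo.prod measurableSet_Ioo) _).symm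
    _ ≤ ENNReal.ofReal |cross g n|⁻¹ * ∫⁻ x in Ω, ‖gradient U x‖ₑ ^ 2 := by
        refine setLIntegral_planeChart_le a hT.cross_ne_zero
          ((measurable_gradient U).enorm.pow_const 2) hΩ ?_
        filter_upwards [hnhds] with z hz hzB
        obtain ⟨j, hj, hzj⟩ := mem_iUnion₂.1 hzB
        have hj' : j ≤ 2 * N := Nat.lt_succ_iff.1 (Finset.mem_range.1 hj)
        exact hint (mem_interior_iff_mem_nhds.2 (mem_of_superset (hz j hj' hzj)
          (T.convexHull_subset_closure (hT.mem_elements j hj'))))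
    _ = h1Seminorm Ω U ^ 2 := by
        rw [abs_cross_eq_one hT.norm_tangent hT.norm_normal hT.inner_eq_zero, inv_one,
          ENNReal.ofReal_one, one_mul, h1Seminorm_sq]

theorem sum_normal_slope_sq_le (hT : T.IsZigzagBand a g n h hbar N) (hh : 0 < h) (hb : 0 < hbar)
    (hΩ : MeasurableSet Ω) (hint : interior (closure Ω) ⊆ Ω) {l : ℕ → Plane →ₗ[ℝ] ℝ} {c : ℕ → ℝ}
    (hl : ∀ j ≤ 2 * N, ∀ x ∈ convexHull ℝ (zigzagTriangle a g n h hbar j), U x = l j x + c j)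
    {M : ℝ≥0} (hM : h1Seminorm Ω U ≤ M) :
    ∑ j ∈ Finset.range (2 * N + 1), l j n ^ 2 ≤ 9 * M ^ 2 / (h * hbar) := by
  have hle := (hT.sum_enorm_normal_slope_sq_le hh hb hΩ hint hl).trans (pow_le_pow_left' hM 2)
  have hsum : ∑ j ∈ Finset.range (2 * N + 1), ‖l j n‖ₑ ^ 2 =
      ENNReal.ofReal (∑ j ∈ Finset.range (2 * N + 1), l j n ^ 2) := by
    rw [ENNReal.ofReal_sum_of_nonneg fun j _ ↦ sq_nonneg _]
    refine Finset.sum_congr rfl fun j _ ↦ ?_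
    rw [← ofReal_norm, ← ENNReal.ofReal_pow (norm_nonneg _), Real.norm_eq_abs, sq_abs]
  rw [hsum, ← ENNReal.ofReal_mul (Finset.sum_nonneg fun j _ ↦ sq_nonneg _),
    ← ENNReal.ofReal_coe_nnreal, ← ENNReal.ofReal_pow M.coe_nonneg,
    ENNReal.ofReal_le_ofReal_iff (by positivity)] at hle
  rw [le_div_iff₀ (by positivity)]
  linarith

theorem tangential_slope_sub_sq_le (hT : T.IsZigzagBand a g n h hbar N) (hh : 0 < h)
    (hb : 0 < hbar) (hΩ : MeasurableSet Ω) (hint : interior (closure Ω) ⊆ Ω)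
    {l : ℕ → Plane →ₗ[ℝ] ℝ} {c : ℕ → ℝ}
    (hl : ∀ j ≤ 2 * N, ∀ x ∈ convexHull ℝ (zigzagTriangle a g n h hbar j), U x = l j x + c j)
    {M : ℝ≥0} (hM : h1Seminorm Ω U ≤ M) {k : ℕ} (hk : k ≤ 2 * N) :
    (l k g - l 0 g) ^ 2 ≤ 288 * Metric.diam (closure Ω) * M ^ 2 * (hbar / h ^ 4) := by
  have hN : (2 * N + 1 : ℝ) ≤ 2 * (Metric.diam (closure Ω) / h) := by
    have := hT.length_le_diam hh
    rw [← le_div_iff₀ hh] at this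
    linarith
  calc (l k g - l 0 g) ^ 2
      = |l k g - l 0 g| ^ 2 := (sq_abs _).symm
    _ ≤ (2 * (2 * hbar / h) * ∑ j ∈ Finset.range (2 * N + 1), |l j n|) ^ 2 := by
        gcongr
        exact abs_sub_le_mul_sum_of_abs_sub_succ_le (u := fun j ↦ l j g) (v := fun j ↦ l j n)
          (by positivity) (fun j hj ↦
            abs_tangential_slope_sub_le hh hb (hl j hj.le) (hl (j + 1) hj)) hk
    _ = (4 * hbar / h) ^ 2 * (∑ j ∈ Finset.range (2 * N + 1), |l j n|) ^ 2 := by ring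
    _ ≤ (4 * hbar / h) ^ 2 * ((2 * N + 1) * ∑ j ∈ Finset.range (2 * N + 1), l j n ^ 2) := by
        gcongr
        simpa using sq_sum_le_card_mul_sum_sq (s := Finset.range (2 * N + 1))
          (f := fun j ↦ |l j n|)
    _ ≤ (4 * hbar / h) ^ 2 *
          (2 * (Metric.diam (closure Ω) / h) * (9 * M ^ 2 / (h * hbar))) := by
        gcongr
        exact hT.sum_normal_slope_sq_le hh hb hΩ hint hl hM
    _ = 288 * Metric.diam (closure Ω) * M ^ 2 * (hbar / h ^ 4) := by
        field_simp
        ring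

theorem exists_abs_sub_sub_le (hT : T.IsZigzagBand a g n h hbar N) (hh : 0 < h)
    (hb : 0 < hbar) (hΩ : MeasurableSet Ω) (hint : interior (closure Ω) ⊆ Ω)
    (hU : U ∈ T.femSpace) {M : ℝ≥0} (hM : h1Seminorm Ω U ≤ M) {ε : ℝ} (hε : 0 ≤ ε)
    (hflat : 288 * Metric.diam (closure Ω) * M ^ 2 * (hbar / h ^ 4) ≤ ε ^ 2) :
    ∃ t : ℝ, ∀ s s' : ℝ, 0 ≤ s → s ≤ s' → s' ≤ (N + 1) * h →
      |U (a + s' • g) - U (a + s • g) - t * (s' - s)| ≤ ε * (s' - s) := by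
  have hpiece : ∀ j ≤ 2 * N, ∃ (l : Plane →ₗ[ℝ] ℝ) (c : ℝ),
      ∀ x ∈ convexHull ℝ (zigzagTriangle a g n h hbar j), U x = l x + c :=
    fun j hj ↦ hU.2 _ (hT.mem_elements j hj)
  choose! l c hl using hpiece
  refine ⟨l 0 g, fun s s' hs hss' hs' ↦ ?_⟩
  refine abs_sub_sub_le_of_piecewise_affine (f := fun r ↦ U (a + r • g)) hh
    (hU.1.comp (by fun_prop) fun r hr ↦ hT.edge_mem_closure hh hr) (fun i hi ↦ ?_) hs hss' hs'
  refine ⟨l (2 * i) g, l (2 * i) a + c (2 * i), ?_, fun r hr ↦ ?_⟩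
  · exact abs_le_of_sq_le_sq
      ((hT.tangential_slope_sub_sq_le hh hb hΩ hint hl hM (by omega)).trans hflat) hε
  · rw [hl _ (by omega) _ (mem_convexHull_zigzagTriangle_two_mul n hh hbar hr)]
    simp only [map_add, map_smul, smul_eq_mul]
    ring

end IsZigzagBand

end Triangulation

end ZigzagBand

section SecondDifferences

theorem quadSol_second_difference {a g : Plane} (hg : ‖g‖ = 1) (s m : ℝ) :
    quadSol (a + (s + 2 * m) • g) - 2 * quadSol (a + (s + m) • g) + quadSol (a + s • g) =
      2 * m ^ 2 := by
  have h1 := EuclideanSpace.real_norm_sq_eq g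
  rw [hg, Fin.sum_univ_two] at h1
  simp only [quadSol, PiLp.add_apply, PiLp.smul_apply, smul_eq_mul]
  linear_combination (-2 * m ^ 2) * h1

theorem abs_second_difference_le {f : ℝ → ℝ} {t ε L : ℝ}
    (hf : ∀ s s', 0 ≤ s → s ≤ s' → s' ≤ L → |f s' - f s - t * (s' - s)| ≤ ε * (s' - s))
    {s m : ℝ} (hs : 0 ≤ s) (hm : 0 ≤ m) (hsL : s + 2 * m ≤ L) :
    |f (s + 2 * m) - 2 * f (s + m) + f s| ≤ 2 * ε * m := by
  have h1 := hf s (s + m) hs (by linarith) (by linarith)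
  have h2 := hf (s + m) (s + 2 * m) (by linarith) (by linarith) hsL
  rw [abs_le] at *
  constructor <;> linarith

theorem ofReal_mul_le_setLIntegral_of_le_abs_second_difference {F : ℝ → ℝ} {m κ : ℝ} (hm : 0 ≤ m)
    (hF : ContinuousOn F (Icc 0 (2 * m)))
    (hκ : ∀ s ∈ Ioc 0 m, κ ≤ |F (s + 2 * m) - 2 * F (s + m) + F s|) :
    ENNReal.ofReal (m * κ) ≤ 2 * ∫⁻ s in Ioc 0 (2 * m), ‖F (s + m) - F s‖ₑ := by
  set V : ℝ → ℝ≥0∞ := fun s ↦ ‖F (s + m) - F s‖ₑ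
  have hpoint (s) (hs : s ∈ Ioc 0 m) : ENNReal.ofReal κ ≤ V s + V (s + m) := by
    have hadd := enorm_sub_le (a := F (s + m + m) - F (s + m)) (b := F (s + m) - F s)
    rw [add_comm]
    refine (ENNReal.ofReal_le_ofReal (hκ s hs)).trans (le_trans (le_of_eq ?_) hadd)
    rw [← Real.norm_eq_abs, ofReal_norm]
    congr 1
    ring_nf
  have hVm : AEMeasurable V (volume.restrict (Ioc 0 m)) := by
    refine ContinuousOn.aemeasurable (ContinuousOn.enorm (.sub ?_ ?_)) measurableSet_Ioc
    · exact hF.comp (by fun_prop) fun s hs ↦ ⟨by linarith [hs.1], by linarith [hs.2]⟩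
    · exact hF.mono fun s hs ↦ ⟨hs.1.le, by linarith [hs.2]⟩
  calc ENNReal.ofReal (m * κ) = ∫⁻ _ in Ioc 0 m, ENNReal.ofReal κ := by
        rw [setLIntegral_const, Real.volume_Ioc, sub_zero, ENNReal.ofReal_mul hm, mul_comm]
    _ ≤ ∫⁻ s in Ioc 0 m, (V s + V (s + m)) := setLIntegral_mono' measurableSet_Ioc hpoint
    _ = (∫⁻ s in Ioc 0 m, V s) + ∫⁻ s in Ioc 0 (2 * m - m), V (s + m) := by
        rw [lintegral_add_left' hVm, show 2 * m - m = m by ring]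
    _ ≤ (∫⁻ s in Ioc 0 (2 * m), V s) + ∫⁻ s in Ioc 0 (2 * m), V s := by
        gcongr ?_ + ?_
        · exact lintegral_mono_set (Ioc_subset_Ioc_right (by linarith))
        · exact setLIntegral_comp_add_right_le V hm _
    _ = 2 * ∫⁻ s in Ioc 0 (2 * m), V s := (two_mul _).symm

theorem HasLipschitzBoundary.exists_le_h1Seminorm_of_le_abs_second_difference {Ω : Set Plane}
    (h : HasLipschitzBoundary Ω) (hO : IsOpen Ω) (hb : Bornology.IsBounded Ω) {L : ℝ} (hL : 0 < L) :
    ∃ m > 0, 3 * m ≤ L ∧ ∀ κ > 0, ∃ c : ℝ≥0∞, 0 < c ∧ ∀ w : Plane → ℝ, ContinuousOn w (closure Ω) →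
      (∀ p g e, cross g e ≠ 0 → ∀ᶠ s : ℝ in cofinite, ∀ᶠ t : ℝ in cofinite,
        p + s • g + t • e ∈ Ω → DifferentiableAt ℝ w (p + s • g + t • e)) →
      ∀ a g : Plane, ‖g‖ = 1 → (∀ s ∈ Icc 0 L, a + s • g ∈ closure Ω) →
        (∀ s ∈ Ioc 0 m,
          κ ≤ |w (a + (s + 2 * m) • g) - 2 * w (a + (s + m) • g) + w (a + s • g)|) →
        c ≤ h1Seminorm Ω w := by
  obtain ⟨η, hη, hdir⟩ := h.exists_uniform_transversal hO hb
  obtain ⟨m, hm, hmL, hmη⟩ : ∃ m > 0, 3 * m ≤ L ∧ 3 * m < η :=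
    ⟨min L η / 4, by positivity, by linarith [min_le_left L η, lt_min hL hη],
      by linarith [min_le_right L η, lt_min hL hη]⟩
  set A : ℝ≥0∞ := 2 * ((2 * ENNReal.ofReal (η / 2) + ENNReal.ofReal (3 * m - m)) *
    (ENNReal.ofReal η⁻¹ * volume Ω ^ (1 / 2 : ℝ))) with hA
  have hA_top : A ≠ ∞ := by
    have := ENNReal.rpow_ne_top_of_nonneg one_half_pos.le hb.measure_lt_top.ne (x := volume Ω)
    finiteness
  refine ⟨m, hm, hmL, fun κ hκ ↦ ⟨ENNReal.ofReal (η / 2) * ENNReal.ofReal (m * κ) / A,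
    ENNReal.div_pos (by positivity) hA_top, fun w hw hdiff a g hg hedge hsecond ↦ ?_⟩⟩
  have ha : a ∈ closure Ω := by simpa using hedge 0 ⟨le_rfl, hL.le⟩
  obtain ⟨e, he, hcross, hin⟩ := hdir a ha g hg
  have hmem : ∀ s ∈ Ioc 0 (3 * m), ∀ t ∈ Ioc 0 (η / 2), a + s • g + t • e ∈ Ω := by
    refine fun s hs t ht ↦ hin _ (hedge s ⟨hs.1.le, hs.2.trans hmL⟩) ?_ t
      ⟨ht.1, by linarith [ht.2]⟩
    rw [dist_self_add_left, norm_smul, hg, mul_one, Real.norm_of_nonneg hs.1.le]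
    exact hs.2.trans_lt hmη
  have hline := ofReal_mul_le_setLIntegral_of_le_abs_second_difference
    (F := fun s ↦ w (a + s • g)) hm.le
    (hw.comp (by fun_prop) fun s hs ↦ hedge s ⟨hs.1, by linarith [hs.2]⟩) hsecond
  have htrace := setLIntegral_enorm_sub_le_h1Seminorm hO.measurableSet hw hdiff hg.le he
    (abs_pos.1 (hη.trans_le hcross)) hm.le hmem
  refine ENNReal.div_le_of_le_mul ?_
  calc ENNReal.ofReal (η / 2) * ENNReal.ofReal (m * κ)
      ≤ 2 * (ENNReal.ofReal (η / 2) *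
          ∫⁻ s in Ioc 0 (3 * m - m), ‖w (a + (s + m) • g) - w (a + s • g)‖ₑ) := by
        rw [mul_left_comm, show 3 * m - m = 2 * m by ring]
        gcongr
    _ ≤ 2 * ((2 * ENNReal.ofReal (η / 2) + ENNReal.ofReal (3 * m - m)) *
          (ENNReal.ofReal η⁻¹ * (h1Seminorm Ω w * volume Ω ^ (1 / 2 : ℝ)))) := by
        refine mul_le_mul_right (htrace.trans ?_) 2
        gcongr
    _ = h1Seminorm Ω w * A := by
        rw [hA]
        ring

theorem HasLipschitzBoundary.exists_le_h1Seminorm_of_containsBand {Ω : Set Plane}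
    (hlip : HasLipschitzBoundary Ω) (hO : IsOpen Ω) (hb : Bornology.IsBounded Ω) {L : ℝ}
    (hL : 0 < L) :
    ∃ c : ℝ≥0∞, 0 < c ∧ ∃ δ : ℝ, 0 < δ ∧ ∀ (T : Triangulation Ω) (h hbar : ℝ) (N : ℕ)
      (U : Plane → ℝ), T.ContainsBand h hbar N → L ≤ (N + 1) * h → 0 < hbar → hbar ≤ δ * h ^ 4 →
        U ∈ T.femSpace → c ≤ h1Seminorm Ω (fun x ↦ quadSol x - U x) := by
  obtain ⟨m, hm, hmL, hsecond⟩ := hlip.exists_le_h1Seminorm_of_le_abs_second_difference hO hb hL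
  obtain ⟨c, hc, hcw⟩ := hsecond (m ^ 2) (by positivity)
  obtain ⟨M, hM⟩ : ∃ M : ℝ≥0, h1Seminorm Ω quadSol + 1 = M := by
    have := (h1Seminorm_quadSol_lt_top hO.measurableSet hb).ne
    exact ⟨_, (ENNReal.coe_toNNReal (by finiteness)).symm⟩
  set D : ℝ := 288 * Metric.diam (closure Ω) * M ^ 2
  have : 0 ≤ D := by have := Metric.diam_nonneg (s := closure Ω); positivity
  refine ⟨min c 1, lt_min hc one_pos, (m / 2) ^ 2 / (D + 1), by positivity,
    fun T h hbar N U hT hNh hbar0 hflat hU ↦ ?_⟩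
  obtain hw | hw := le_total 1 (h1Seminorm Ω fun x ↦ quadSol x - U x)
  · exact (min_le_right _ _).trans hw
  have hh : 0 < h := pos_of_mul_pos_right (hL.trans_le hNh) (by positivity)
  obtain ⟨a, g, n, hband⟩ := hT.exists_isZigzagBand
  have hUM : h1Seminorm Ω U ≤ M :=
    hM ▸ (Triangulation.h1Seminorm_le_add hO.measurableSet hU).trans (by gcongr)
  have hthin : D * (hbar / h ^ 4) ≤ (m / 2) ^ 2 := by
    rw [← div_le_iff₀ (by positivity), le_div_iff₀ (by positivity)] at hflat
    nlinarith [div_pos hbar0 (pow_pos hh 4)]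
  obtain ⟨t, ht⟩ := hband.exists_abs_sub_sub_le hh hbar0 hO.measurableSet
    (hlip.interior_closure_subset hO) hU hUM (half_pos hm).le hthin
  refine (min_le_left _ _).trans (hcw _ (differentiable_quadSol.continuous.continuousOn.sub hU.1)
    (fun p g e hd ↦ ?_) a g hband.norm_tangent
    (fun s hs ↦ hband.edge_mem_closure hh ⟨hs.1, hs.2.trans hNh⟩) fun s hs ↦ ?_)
  · filter_upwards [T.eventually_cofinite_mem_nhds p hd] with s hs
    filter_upwards [hs] with t ht hmem
    exact (differentiable_quadSol _).sub
      (Triangulation.differentiableAt_of_mem_femSpace hU (subset_closure hmem) ht)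
  · have hUs := abs_second_difference_le ht hs.1.le hm.le (by linarith [hs.2])
    have hus := quadSol_second_difference (a := a) hband.norm_tangent s m
    refine le_trans ?_ (le_abs_self _)
    linarith [(abs_le.1 hUs).2]

end SecondDifferences

theorem mainTheorem5_general {Ω : Set Plane} (hO : IsOpen Ω) (hlip : HasLipschitzBoundary Ω)
    {ι : Type*} {l : Filter ι} [l.NeBot] {T : ι → Triangulation Ω} {L : ℝ} (hL : 0 < L)
    {h hbar : ι → ℝ} {N : ι → ℕ} (hbar_pos : ∀ k, 0 < hbar k)
    (hband : ∀ k, (T k).ContainsBand (h k) (hbar k) (N k)) (hlength : ∀ k, L ≤ (N k + 1) * h k)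
    (hbar_small : hbar =o[l] fun k ↦ h k ^ 4) {U : ι → Plane → ℝ}
    (hU : ∀ k, U k ∈ (T k).femSpace) :
    ¬ Tendsto (fun k ↦ h1Seminorm Ω fun x ↦ quadSol x - U k x) l (𝓝 0) := by
  intro hconv
  obtain ⟨k₀⟩ := l.nonempty_of_neBot
  obtain ⟨c, hc, δ, hδ, hle⟩ :=
    hlip.exists_le_h1Seminorm_of_containsBand hO (T k₀).isBounded hL
  obtain ⟨k, hck, hk⟩ := ((hconv.eventually_lt_const hc).and (hbar_small.bound hδ)).exists
  rw [Real.norm_of_nonneg (hbar_pos k).le, Real.norm_of_nonneg (by positivity)] at hk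
  exact hck.not_ge (hle _ _ _ _ _ (hband k) (hlength k) (hbar_pos k) hk (hU k))

theorem mainTheorem5
    (Ω : Set Plane) (hΩ : IsPolygonalDomain Ω)
    -- the family of triangulations, indexed by the mesh size
    (h₀ : ℝ) (hh₀ : 0 < h₀) (T : ℝ → Triangulation Ω)
    (hT : ∀ h ∈ Ioo 0 h₀, (T h).HasMeshSize h)
    -- the sequence of bands
    (C_L : ℝ) (hC_L : 0 < C_L)
    (h hbar : ℕ → ℝ) (N : ℕ → ℕ)
    (hh : ∀ k, h k ∈ Ioo 0 h₀) (hh_lim : Tendsto h atTop (𝓝 0))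
    (hbar_pos : ∀ k, 0 < hbar k)
    (hband : ∀ k, (T (h k)).ContainsBand (h k) (hbar k) (N k))
    (hL : ∀ k, C_L ≤ ((N k : ℝ) + 1) * h k)
    (hbar_small : hbar =o[atTop] fun k => h k ^ 4)
    -- arbitrary discrete Dirichlet lifts and the corresponding finite element solutions
    (g U : ℝ → Plane → ℝ)
    (hg : ∀ h ∈ Ioo 0 h₀, g h ∈ (T h).femSpace)
    (hU : ∀ h ∈ Ioo 0 h₀, (T h).IsFEMSolution (fun _ => -4) (g h) (U h)) :
    ¬ Tendsto (fun h => h1Seminorm Ω (fun x => quadSol x - U h x)) (𝓝[>] 0) (𝓝 0) := by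
  intro hconv
  exact mainTheorem5_general hΩ.isOpen hΩ.lipschitz hC_L hbar_pos hband hL hbar_small
    (fun k ↦ (hU _ (hh k)).mem_femSpace (hg _ (hh k)))
    (hconv.comp (tendsto_nhdsWithin_iff.2 ⟨hh_lim, .of_forall fun k ↦ (hh k).1⟩))
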